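/- A \emph{set operad} is a positive set species $\mathcal Q$ (a contravariant functor $A\mapsto\mathcal Q_A$ from finite sets and bijections to sets, with $\mathcal Q_\emptyset=\emptyset$) together with a unit in $\mathcal Q_{\{*\}}$ and natural partial compositions $\circ_b:\mathcal Q_B\times\mathcal Q_C\to\mathcal Q_{B\sqcup_b C}$ for $b\in B$, where $B\sqcup_b C=(B\setminus\{b\})\sqcup C$, which are unital and satisfy $\alpha\circ_b(\beta\circ_c\gamma)=(\alpha\circ_b\beta)\circ_c\gamma$ for $b\in B$, $c\in C$ and $(\alpha\circ_b\beta)\circ_{b'}\gamma=(\alpha\circ_{b'}\gamma)\circ_b\beta$ for $b\neq b'$ in $B$. Let $\mathcal P$ be the set species of non-diagonal ordered pairs: $\mathcal P_\emptyset=\emptyset$, $\mathcal P_{\{*\}}=\{\mathbf 1\}$, and $\mathcal P_A=\{(a',a'')\in A\times A : a'\ne a''\}$ if $|A|\ge 2$, with relabelling along a bijection $\phi:A\to B$ given by $(b',b'')\mapsto(\phi^{-1}(b'),\phi^{-1}(b''))$. Define partial compositions by letting $\mathbf 1$ be the unit and $$(a',a'')\circ_a(b',b'')=\begin{cases}(b'',a'')&\text{if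 }a=a',\\(a',b'')&\text{if }a=a'',\\(a',a'')&\text{if }a\notin\{a',a''\}.\end{cases}$$ Let $\mathcal M$ be the magmatic operad, i.e. the free set operad on one binary operation $\nu\in\mathcal M_{\{1,2\}}$ (so $\mathcal M_A$ is the set of planar binary trees with leaves bijectively labelled by $A$), let $\bar\nu$ be $\nu$ with its inputs exchanged, and let $\mathcal T$, the twist-associative operad, be the quotient of $\mathcal M$ by the finest equivalence relation that is compatible with relabellings and partial compositions and identifies $\nu\circ_2\nu$ with $\nu\circ_1\bar\nu$, i.e. imposes $x(yz)=(yx)z$. \textbf{Theorem.} (i) $\mathcal P$ with these partial compositions is a set operad. (ii) The operads $\mathcal P$ and $\mathcal T$ are isomorphic. (iii) $\mathcal T$ governs Thedy rings: for every commutative ring $k$ and every $k$-module $V$, evaluation at the class of $\nu$ is a bijection from the set of ($k$-multilinear) $\mathcal T$-algebra structures on $V$ to the set of $k$-bilinear products on $V$ that satisfy $x(yz)=(yx)z$ for all $x,y,z\in V$ (for $k=\mathbb Z$ these are the Thedy rings). -/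

import Mathlib

namespace SpeciesOperad

/-- The finite set `B ⊔_b C = (B \ {b}) ⊔ C`. -/
abbrev Graft {B : Type} (b : B) (C : Type) : Type := {x : B // x ≠ b} ⊕ C

namespace Graft

/-- Bijections `φ : A ≃ A'` and `ψ : B ≃ B'` induce `A ⊔_a B ≃ A' ⊔_{φ a} B'`. -/
def congr {A A' B B' : Type} (φ : A ≃ A') (ψ : B ≃ B') (a : A) :
    Graft a B ≃ Graft (φ a) B' :=
  Equiv.sumCongr (φ.subtypeEquiv fun x => by simp) ψ

/-- `{*} ⊔_* C` is `C`. -/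
def unitLeft (C : Type) : C ≃ Graft () C where
  toFun c := .inr c
  invFun
    | .inl x => (x.2 rfl).elim
    | .inr c => c
  left_inv _ := rfl
  right_inv := by
    rintro (x | c)
    · exact (x.2 rfl).elim
    · rfl

open Classical in
/-- `B ⊔_b {*}` is `B`, the point `*` taking the place of `b`. -/
noncomputable def unitRight {B : Type} (b : B) : B ≃ Graft b Unit where
  toFun x := if h : x = b then .inr () else .inl ⟨x, h⟩
  invFun
    | .inl x => x
    | .inr _ => b
  left_inv x := by by_cases h : x = b <;> simp [h]
  right_inv := by
    rintro (x | c)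
    · simp [x.2]
    · simp

/-- The canonical bijection `B ⊔_b (C ⊔_c D) ≃ (B ⊔_b C) ⊔_c D`. -/
def assoc {B C : Type} (b : B) (c : C) (D : Type) :
    Graft b (Graft c D) ≃ Graft (Sum.inr c : Graft b C) D where
  toFun
    | .inl x => .inl ⟨.inl x, by simp⟩
    | .inr (.inl y) => .inl ⟨.inr y.1, by simpa using y.2⟩
    | .inr (.inr d) => .inr d
  invFun
    | .inl ⟨.inl x, _⟩ => .inl x
    | .inl ⟨.inr y, h⟩ => .inr (.inl ⟨y, by simpa using h⟩)
    | .inr d => .inr (.inr d)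
  left_inv := by rintro (x | y | d) <;> rfl
  right_inv := by rintro (⟨x | y, h⟩ | d) <;> rfl

/-- For `b ≠ b'`, the canonical bijection `(B ⊔_b C) ⊔_{b'} D ≃ (B ⊔_{b'} D) ⊔_b C`. -/
def exchange {B : Type} (b b' : B) (h : b ≠ b') (C D : Type) :
    Graft (Sum.inl ⟨b', h.symm⟩ : Graft b C) D ≃ Graft (Sum.inl ⟨b, h⟩ : Graft b' D) C where
  toFun
    | .inl ⟨.inl x, hx⟩ => .inl ⟨.inl ⟨x.1, fun e => hx (by simp [Subtype.ext_iff, e])⟩,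
        fun e => x.2 (by simpa [Subtype.ext_iff] using e)⟩
    | .inl ⟨.inr c, _⟩ => .inr c
    | .inr d => .inl ⟨.inr d, by simp⟩
  invFun
    | .inl ⟨.inl x, hx⟩ => .inl ⟨.inl ⟨x.1, fun e => hx (by simp [Subtype.ext_iff, e])⟩,
        fun e => x.2 (by simpa [Subtype.ext_iff] using e)⟩
    | .inl ⟨.inr d, _⟩ => .inr d
    | .inr c => .inl ⟨.inr c, by simp⟩
  left_inv := by rintro (⟨x | c, hx⟩ | d) <;> rfl
  right_inv := by rintro (⟨x | d, hx⟩ | c) <;> rfl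

end Graft

/-- The data of a set operad in the species formalism: a set `obj A` for every finite set `A`,
contravariant relabelling maps along bijections, a unit on the one-point set, and partial
compositions. The laws are stated in `OperadData.IsOperad`. -/
structure OperadData where
  obj : (A : Type) → [Finite A] → Type
  relabel : {A B : Type} → [Finite A] → [Finite B] → (A ≃ B) → obj B → obj A
  unit : obj Unit
  comp : {B C : Type} → [Finite B] → [Finite C] → (b : B) → obj B → obj C → obj (Graft b C)

namespace OperadData

/-- The laws of a set operad: `obj` is a positive contravariant species of sets, the partial
compositions are natural, sequentially and parallelly associative, and unital. -/
structure IsOperad (P : OperadData) : Prop where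
  relabel_refl : ∀ {A : Type} [Finite A] (p : P.obj A), P.relabel (Equiv.refl A) p = p
  relabel_trans : ∀ {A B C : Type} [Finite A] [Finite B] [Finite C] (φ : A ≃ B) (ψ : B ≃ C)
    (p : P.obj C), P.relabel (φ.trans ψ) p = P.relabel φ (P.relabel ψ p)
  positive : ∀ {A : Type} [Finite A], IsEmpty A → IsEmpty (P.obj A)
  comp_natural : ∀ {A A' B B' : Type} [Finite A] [Finite A'] [Finite B] [Finite B']
    (φ : A ≃ A') (ψ : B ≃ B') (a : A) (p : P.obj A') (q : P.obj B'),
    P.comp a (P.relabel φ p) (P.relabel ψ q) =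
      P.relabel (Graft.congr φ ψ a) (P.comp (φ a) p q)
  comp_assoc : ∀ {B C D : Type} [Finite B] [Finite C] [Finite D] (b : B) (c : C)
    (p : P.obj B) (q : P.obj C) (r : P.obj D),
    P.comp b p (P.comp c q r) =
      P.relabel (Graft.assoc b c D) (P.comp (Sum.inr c : Graft b C) (P.comp b p q) r)
  comp_exchange : ∀ {B C D : Type} [Finite B] [Finite C] [Finite D] (b b' : B) (h : b ≠ b')
    (p : P.obj B) (q : P.obj C) (r : P.obj D),
    P.comp (Sum.inl ⟨b', h.symm⟩ : Graft b C) (P.comp b p q) r =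
      P.relabel (Graft.exchange b b' h C D)
        (P.comp (Sum.inl ⟨b, h⟩ : Graft b' D) (P.comp b' p r) q)
  unit_comp : ∀ {C : Type} [Finite C] (q : P.obj C),
    P.relabel (Graft.unitLeft C) (P.comp () P.unit q) = q
  comp_unit : ∀ {B : Type} [Finite B] (b : B) (p : P.obj B),
    P.relabel (Graft.unitRight b) (P.comp b p P.unit) = p

/-- Isomorphisms of set operads: bijections on all components that respect relabellings, units
and partial compositions. -/
structure Iso (P Q : OperadData) where
  equiv : (A : Type) → [Finite A] → P.obj A ≃ Q.obj A
  map_relabel : ∀ {A B : Type} [Finite A] [Finite B] (φ : A ≃ B) (p : P.obj B),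
    equiv A (P.relabel φ p) = Q.relabel φ (equiv B p)
  map_unit : equiv Unit P.unit = Q.unit
  map_comp : ∀ {B C : Type} [Finite B] [Finite C] (b : B) (p : P.obj B) (q : P.obj C),
    equiv (Graft b C) (P.comp b p q) = Q.comp b (equiv B p) (equiv C q)

/-- The finest family of equivalence relations on the components of `P` that contains `r` and is
compatible with relabellings and partial compositions. -/
inductive Congruence (P : OperadData) (r : (A : Type) → [Finite A] → P.obj A → P.obj A → Prop) :
    (A : Type) → [Finite A] → P.obj A → P.obj A → Prop
  | of {A : Type} [Finite A] {p q : P.obj A} : r A p q → Congruence P r A p q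
  | refl {A : Type} [Finite A] (p : P.obj A) : Congruence P r A p p
  | symm {A : Type} [Finite A] {p q : P.obj A} : Congruence P r A p q → Congruence P r A q p
  | trans {A : Type} [Finite A] {p q s : P.obj A} :
      Congruence P r A p q → Congruence P r A q s → Congruence P r A p s
  | relabel {A B : Type} [Finite A] [Finite B] (φ : A ≃ B) {p q : P.obj B} :
      Congruence P r B p q → Congruence P r A (P.relabel φ p) (P.relabel φ q)
  | comp {B C : Type} [Finite B] [Finite C] (b : B) {p p' : P.obj B} {q q' : P.obj C} :
      Congruence P r B p p' → Congruence P r C q q' →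
        Congruence P r (Graft b C) (P.comp b p q) (P.comp b p' q')

/-- The equivalence relation `Congruence P r A` on `P.obj A`. -/
def congruenceSetoid (P : OperadData)
    (r : (A : Type) → [Finite A] → P.obj A → P.obj A → Prop) (A : Type) [Finite A] :
    Setoid (P.obj A) where
  r := Congruence P r A
  iseqv := ⟨.refl, .symm, .trans⟩

/-- The quotient of a set operad by the operadic congruence generated by `r`. -/
def quotient (P : OperadData) (r : (A : Type) → [Finite A] → P.obj A → P.obj A → Prop) :
    OperadData where
  obj A _ := Quotient (congruenceSetoid P r A)
  relabel φ := Quotient.map (P.relabel φ) fun _ _ h => .relabel φ h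
  unit := Quotient.mk _ P.unit
  comp b := Quotient.map₂ (P.comp b) fun _ _ h _ _ h' => .comp b h h'

/-- The projection of a set operad onto its quotient. -/
def toQuotient (P : OperadData) (r : (A : Type) → [Finite A] → P.obj A → P.obj A → Prop)
    {A : Type} [Finite A] (p : P.obj A) : (P.quotient r).obj A :=
  Quotient.mk (congruenceSetoid P r A) p

open Classical in
/-- A `P`-algebra structure on a `k`-module `V`: every `p ∈ P_A` acts as a `k`-multilinear map
`V^A → V`, compatibly with relabellings, the unit and partial compositions. (Equivalently, an
algebra over the `k`-linearization of `P`.) -/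
@[ext]
structure LinearAlgebra (P : OperadData) (k V : Type*) [CommRing k] [AddCommGroup V]
    [Module k V] where
  act : (A : Type) → [Finite A] → P.obj A → MultilinearMap k (fun _ : A => V) V
  act_relabel : ∀ {A B : Type} [Finite A] [Finite B] (φ : A ≃ B) (p : P.obj B) (v : A → V),
    act A (P.relabel φ p) v = act B p (fun b => v (φ.symm b))
  act_unit : ∀ v : Unit → V, act Unit P.unit v = v ()
  act_comp : ∀ {B C : Type} [Finite B] [Finite C] (b : B) (p : P.obj B) (q : P.obj C)
    (v : Graft b C → V),
    act (Graft b C) (P.comp b p q) v =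
      act B p (fun x => if h : x = b then act C q (fun c => v (.inr c)) else v (.inl ⟨x, h⟩))

end OperadData

/-! ### The species of non-diagonal ordered pairs -/

/-- The species of non-diagonal ordered pairs: if `A` is a one-point set, the only element is
`unit`; if `A` has at least two elements, the elements are the pairs `(a', a'')` with `a' ≠ a''`;
if `A` is empty there is no element. -/
inductive OrderedPair (A : Type) : Type
  | unit (a : A) (h : ∀ x : A, x = a)
  | pair (a' a'' : A) (h : a' ≠ a'')

namespace OrderedPair

def relabel {A B : Type} (φ : A ≃ B) : OrderedPair B → OrderedPair A
  | unit b h => unit (φ.symm b) fun x => by rw [Equiv.eq_symm_apply]; exact h (φ x)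
  | pair b' b'' h => pair (φ.symm b') (φ.symm b'') fun e => h (φ.symm.injective e)

open Classical in
/-- The map `A → (A \ {a}) ⊔ B` sending `a` to `b ∈ B` and fixing all other elements. -/
noncomputable def subst {A B : Type} (a : A) (b : B) (x : A) : Graft a B :=
  if h : x = a then .inr b else .inl ⟨x, h⟩

theorem subst_injective {A B : Type} (a : A) (b : B) : Function.Injective (subst a b) := by
  intro x y h
  unfold subst at h
  split_ifs at h with h1 h2 h2
  · rw [h1, h2]
  · simpa using h

open Classical in
/-- The partial compositions: `unit` is neutral, and `(a', a'') ∘_a (b', b'')` is `(b'', a'')` if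
`a = a'`, is `(a', b'')` if `a = a''`, and is `(a', a'')` otherwise. -/
noncomputable def comp {A B : Type} (a : A) : OrderedPair A → OrderedPair B →
    OrderedPair (Graft a B)
  | unit a₀ h, unit b h' => unit (.inr b) <| by
      rintro (x | y)
      · exact (x.2 ((h x.1).trans (h a).symm)).elim
      · rw [h' y]
  | unit _ _, pair b' b'' hb => pair (.inr b') (.inr b'') fun e => hb (Sum.inr_injective e)
  | pair a' a'' ha, unit b _ => pair (subst a b a') (subst a b a'')
      fun e => ha (subst_injective a b e)
  | pair a' a'' ha, pair _ b'' _ =>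
      if h₁ : a = a' then pair (.inr b'') (.inl ⟨a'', fun e => ha (h₁.symm.trans e.symm)⟩) (by simp)
      else if h₂ : a = a'' then pair (.inl ⟨a', Ne.symm h₁⟩) (.inr b'') (by simp)
      else pair (.inl ⟨a', Ne.symm h₁⟩) (.inl ⟨a'', Ne.symm h₂⟩) (by simpa using ha)

end OrderedPair

/-- The set operad of non-diagonal ordered pairs. -/
noncomputable def orderedPairs : OperadData where
  obj A _ := OrderedPair A
  relabel := OrderedPair.relabel
  unit := .unit () fun _ => rfl
  comp := OrderedPair.comp

/-! ### The magmatic operad and the twist-associative operad -/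

/-- The list of the leaves, from left to right, of a nonassociative word, that is of a planar
binary tree with leaves labelled by `A`. -/
def leaves {A : Type} : FreeMagma A → List A
  | .of a => [a]
  | .mul s t => leaves s ++ leaves t

@[simp] theorem leaves_of {A : Type} (a : A) : leaves (FreeMagma.of a) = [a] := rfl

@[simp] theorem leaves_mul {A : Type} (s t : FreeMagma A) :
    leaves (s * t) = leaves s ++ leaves t := rfl

/-- Every element of `A` labels exactly one leaf. -/
def IsMultilinear {A : Type} (t : FreeMagma A) : Prop :=
  (leaves t).Nodup ∧ ∀ a : A, a ∈ leaves t

theorem leaves_lift {A B : Type} (f : A → FreeMagma B) (t : FreeMagma A) :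
    leaves (FreeMagma.lift f t) = (leaves t).flatMap fun a => leaves (f a) := by
  induction t using FreeMagma.recOnMul with
  | ih1 a => simp
  | ih2 s t hs ht => simp [hs, ht]

theorem leaves_map {A B : Type} (f : A → B) (t : FreeMagma A) :
    leaves (FreeMagma.map f t) = (leaves t).map f := by
  induction t using FreeMagma.recOnMul with
  | ih1 a => simp
  | ih2 s t hs ht => simp [hs, ht]

open Classical in
/-- Substitution of the word `t` for the letter `b` in the word `s`. -/
noncomputable def graftTree {B C : Type} (b : B) (s : FreeMagma B) (t : FreeMagma C) :
    FreeMagma (Graft b C) :=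
  FreeMagma.lift (fun x => if h : x = b then FreeMagma.map Sum.inr t
    else FreeMagma.of (Sum.inl ⟨x, h⟩)) s

theorem IsMultilinear.map {A B : Type} (φ : A ≃ B) {t : FreeMagma B} (h : IsMultilinear t) :
    IsMultilinear (FreeMagma.map φ.symm t) := by
  refine ⟨?_, fun a => ?_⟩
  · rw [leaves_map]; exact h.1.map φ.symm.injective
  · rw [leaves_map]; exact List.mem_map.2 ⟨φ a, h.2 _, by simp⟩

theorem IsMultilinear.graftTree {B C : Type} (b : B) {s : FreeMagma B} {t : FreeMagma C}
    (hs : IsMultilinear s) (ht : IsMultilinear t) : IsMultilinear (graftTree b s t) := by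
  classical
  unfold SpeciesOperad.graftTree
  refine ⟨?_, fun a => ?_⟩
  · rw [leaves_lift, List.nodup_flatMap]
    refine ⟨fun x _ => ?_, hs.1.imp ?_⟩
    · split_ifs
      · rw [leaves_map]; exact ht.1.map Sum.inr_injective
      · simp
    · intro x y hxy z hz hz'
      dsimp only at hz hz'
      split_ifs at hz hz' with h1 h2 h2
      · exact hxy (h1.trans h2.symm)
      · rw [leaves_map] at hz; simp at hz hz'; grind
      · rw [leaves_map] at hz'; simp at hz hz'; grind
      · simp at hz hz'; grind
  · rw [leaves_lift, List.mem_flatMap]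
    rcases a with x | c
    · exact ⟨x, hs.2 _, by simp [x.2]⟩
    · exact ⟨b, hs.2 _, by simpa [leaves_map] using ht.2 c⟩

/-- The magmatic operad, free on one binary operation: the component at `A` consists of the
nonassociative words (planar binary trees) in which every element of `A` occurs exactly once, and
partial composition is substitution. -/
noncomputable def magmatic : OperadData where
  obj A _ := {t : FreeMagma A // IsMultilinear t}
  relabel φ t := ⟨FreeMagma.map φ.symm t.1, t.2.map φ⟩
  unit := ⟨FreeMagma.of (), by simp [IsMultilinear]⟩
  comp b s t := ⟨graftTree b s.1 t.1, s.2.graftTree b t.2⟩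

/-- The binary generator `ν = x₁ x₂` of the magmatic operad (the inputs `1, 2` being written
`0, 1 : Fin 2`). -/
noncomputable def generator : magmatic.obj (Fin 2) :=
  ⟨FreeMagma.of 0 * FreeMagma.of 1, by simp, by simp [Fin.forall_fin_two]⟩

/-- The generator with exchanged inputs, `x₂ x₁`. -/
noncomputable def generatorSwap : magmatic.obj (Fin 2) :=
  magmatic.relabel (Equiv.swap (0 : Fin 2) 1) generator

/-- The identification of the inputs of `ν ∘₂ ν` with those of `ν ∘₁ ν̄`: writing `{a, b}` for the
second copy of `{1, 2}`, this is `{1, a, b} → {a, b, 2}`, `1 ↦ a`, `a ↦ b`, `b ↦ 2`. -/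
def twistEquiv : Graft (1 : Fin 2) (Fin 2) ≃ Graft (0 : Fin 2) (Fin 2) where
  toFun
    | .inl _ => .inr 0
    | .inr 0 => .inr 1
    | .inr 1 => .inl ⟨1, by decide⟩
  invFun
    | .inl _ => .inr 1
    | .inr 0 => .inl ⟨0, by decide⟩
    | .inr 1 => .inr 0
  left_inv := by decide
  right_inv := by decide

/-- The twist-associativity relation `ν ∘₂ ν = ν ∘₁ ν̄`, that is `x(yz) = (yx)z`. -/
inductive TwistRelation : (A : Type) → [Finite A] → magmatic.obj A → magmatic.obj A → Prop
  | twist : TwistRelation (Graft (1 : Fin 2) (Fin 2))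
      (magmatic.comp 1 generator generator)
      (magmatic.relabel twistEquiv (magmatic.comp 0 generator generatorSwap))

/-- The twist-associative operad. -/
noncomputable def twistAssociative : OperadData := magmatic.quotient TwistRelation

/-- The binary generator of the twist-associative operad. -/
noncomputable def twistGenerator : twistAssociative.obj (Fin 2) :=
  magmatic.toQuotient TwistRelation generator

end SpeciesOperad

/-!
Write `R t` for the rightmost leaf of a tree `t`. Sending a product `s * t` to the pair `(R s, R t)`
and a single leaf to `unit` is compatible with relabellings and substitutions (`pairHom`) and
surjective (`exists_toPair_eq`). The operad laws of the ordered pairs are therefore inherited from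
the magmatic operad, where they are identities between substitutions. The two sides of
`x (y z) = (y x) z` have the same pair `(x, z)`, so the map descends to the twist-associative operad.

It remains to see that the pair of a multilinear tree determines its class. In any magma with
`x (y z) = (y x) z`, left multiplication by a product `y x` is the composite of the left
multiplications by `x` and by `y`; hence left multiplication by a tree is the composite of the left
multiplications by its leaves (`mul_eval_eq_foldl`), and every product of trees is a right comb
`w₁ (w₂ (⋯ (wₙ b)))`. Moreover `a (x (y z)) = (y (x a)) z = ((x y) a) z = a (y (x z))`
(`mul_left_comm_of_twist`), so that `w₂, …, wₙ` may be permuted. Thus `s * t` depends only on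
`w₁ = R s`, on `b = R t` and on its set of leaves (`eval_mul_eq_of_rightmost`). This is applied to
the quotient of the free magma on `A` by `twistCon A`, a congruence defined on all trees which
restricts to the operadic congruence on multilinear ones.

For algebras, a tree is evaluated in a module with a bilinear product; on multilinear trees the
result is multilinear, and it respects the congruence if the product satisfies the identity. An
algebra is determined by the action of the generator because the generator and the unit generate
the magmatic operad (`magmatic_induction`).
-/

namespace SpeciesOperad

/-! ### Morphisms of operads -/

namespace OperadData

/-- Morphisms of operad data: families of maps that respect relabellings, the unit and partial
compositions. -/
structure Hom (P Q : OperadData) where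
  toFun : (A : Type) → [Finite A] → P.obj A → Q.obj A
  map_relabel : ∀ {A B : Type} [Finite A] [Finite B] (φ : A ≃ B) (p : P.obj B),
    toFun A (P.relabel φ p) = Q.relabel φ (toFun B p)
  map_unit : toFun Unit P.unit = Q.unit
  map_comp : ∀ {B C : Type} [Finite B] [Finite C] (b : B) (p : P.obj B) (q : P.obj C),
    toFun (Graft b C) (P.comp b p q) = Q.comp b (toFun B p) (toFun C q)

/-- The laws of an operad are inherited by surjective images. -/
theorem IsOperad.of_surjective {P Q : OperadData} (hP : P.IsOperad) (f : P.Hom Q)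
    (hf : ∀ (A : Type) [Finite A], Function.Surjective (f.toFun A)) : Q.IsOperad where
  relabel_refl p := by
    obtain ⟨p, rfl⟩ := hf _ p
    rw [← f.map_relabel, hP.relabel_refl]
  relabel_trans φ ψ p := by
    obtain ⟨p, rfl⟩ := hf _ p
    simp only [← f.map_relabel, hP.relabel_trans]
  positive h := ⟨fun p => let ⟨p, _⟩ := hf _ p; (hP.positive h).elim p⟩
  comp_natural φ ψ a p q := by
    obtain ⟨p, rfl⟩ := hf _ p
    obtain ⟨q, rfl⟩ := hf _ q
    simp only [← f.map_relabel, ← f.map_comp, hP.comp_natural]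
  comp_assoc b c p q r := by
    obtain ⟨p, rfl⟩ := hf _ p
    obtain ⟨q, rfl⟩ := hf _ q
    obtain ⟨r, rfl⟩ := hf _ r
    simp only [← f.map_relabel, ← f.map_comp, hP.comp_assoc]
  comp_exchange b b' h p q r := by
    obtain ⟨p, rfl⟩ := hf _ p
    obtain ⟨q, rfl⟩ := hf _ q
    obtain ⟨r, rfl⟩ := hf _ r
    rw [← f.map_comp, ← f.map_comp, hP.comp_exchange b b' h]
    simp only [← f.map_relabel, ← f.map_comp]
  unit_comp q := by
    obtain ⟨q, rfl⟩ := hf _ q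
    rw [← f.map_unit, ← f.map_comp, ← f.map_relabel, hP.unit_comp]
  comp_unit b p := by
    obtain ⟨p, rfl⟩ := hf _ p
    rw [← f.map_unit, ← f.map_comp, ← f.map_relabel, hP.comp_unit]

end OperadData

/-! ### Trees: maps, rightmost leaves, substitution -/

variable {A B C D : Type}

@[simp] theorem graftTree_of_self (b : B) (t : FreeMagma C) :
    graftTree b (FreeMagma.of b) t = FreeMagma.map Sum.inr t := by
  simp [graftTree]

theorem graftTree_of_ne {b x : B} (h : x ≠ b) (t : FreeMagma C) :
    graftTree b (FreeMagma.of x) t = FreeMagma.of (Sum.inl ⟨x, h⟩) := by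
  simp [graftTree, h]

@[simp] theorem graftTree_mul (b : B) (s s' : FreeMagma B) (t : FreeMagma C) :
    graftTree b (s * s') t = graftTree b s t * graftTree b s' t := by
  simp [graftTree]

/-- The rightmost leaf of a tree. -/
def rightmost : FreeMagma A → A
  | .of a => a
  | .mul _ t => rightmost t

@[simp] theorem rightmost_of (a : A) : rightmost (FreeMagma.of a) = a := rfl

@[simp] theorem rightmost_mul (s t : FreeMagma A) : rightmost (s * t) = rightmost t := rfl

theorem map_map_tree (g : B → C) (f : A → B) (t : FreeMagma A) :
    FreeMagma.map g (FreeMagma.map f t) = FreeMagma.map (fun a => g (f a)) t := by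
  induction t using FreeMagma.recOnMul with
  | ih1 a => simp
  | ih2 s t hs ht => simp [hs, ht]

theorem map_id_tree (t : FreeMagma A) : FreeMagma.map (fun a => a) t = t := by
  induction t using FreeMagma.recOnMul with
  | ih1 a => simp
  | ih2 s t hs ht => simp [hs, ht]

theorem map_congr_tree {f g : A → B} {t : FreeMagma A} (h : ∀ a ∈ leaves t, f a = g a) :
    FreeMagma.map f t = FreeMagma.map g t := by
  induction t using FreeMagma.recOnMul with
  | ih1 a => simp [h a (by simp)]
  | ih2 s t hs ht =>
    simp [hs fun a ha => h a (by simp [ha]), ht fun a ha => h a (by simp [ha])]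

theorem map_injective_tree {f : A → B} (hf : Function.Injective f) :
    Function.Injective (FreeMagma.map f) := by
  intro s t h
  have : Nonempty A := ⟨rightmost s⟩
  have := congrArg (FreeMagma.map (Function.invFun f)) h
  simpa [map_map_tree, Function.leftInverse_invFun hf _, map_id_tree] using this

theorem eq_mul_of_map_eq_mul {f : B → A} {p : FreeMagma B} {s t : FreeMagma A}
    (h : FreeMagma.map f p = s * t) :
    ∃ p₁ p₂, p = p₁ * p₂ ∧ FreeMagma.map f p₁ = s ∧ FreeMagma.map f p₂ = t := by
  induction p using FreeMagma.recOnMul with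
  | ih1 a => cases h
  | ih2 p₁ p₂ _ _ =>
    rw [map_mul] at h
    injection h with h₁ h₂
    exact ⟨p₁, p₂, rfl, h₁, h₂⟩

theorem rightmost_map (f : A → B) (t : FreeMagma A) :
    rightmost (FreeMagma.map f t) = f (rightmost t) := by
  induction t using FreeMagma.recOnMul with
  | ih1 a => simp
  | ih2 s t hs ht => simp [ht]

theorem exists_leaves_eq_append_rightmost (t : FreeMagma A) :
    ∃ l, leaves t = l ++ [rightmost t] := by
  induction t using FreeMagma.recOnMul with
  | ih1 a => exact ⟨[], rfl⟩
  | ih2 s t _ ht =>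
    obtain ⟨l, hl⟩ := ht
    exact ⟨leaves s ++ l, by simp [hl]⟩

theorem rightmost_mem_leaves (t : FreeMagma A) : rightmost t ∈ leaves t := by
  obtain ⟨l, hl⟩ := exists_leaves_eq_append_rightmost t
  simp [hl]

theorem rightmost_graftTree (b : B) (s : FreeMagma B) (t : FreeMagma C) :
    rightmost (graftTree b s t) = OrderedPair.subst b (rightmost t) (rightmost s) := by
  induction s using FreeMagma.recOnMul with
  | ih1 x =>
    by_cases h : x = b
    · subst h; simp [rightmost_map, OrderedPair.subst]
    · simp [graftTree_of_ne h, OrderedPair.subst, h]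
  | ih2 s s' _ hs' => simp [hs']

/-! ### The magmatic operad satisfies the laws of an operad -/

theorem graftTree_map (φ : A ≃ B) (ψ : C ≃ D) (a : A) (s : FreeMagma B) (t : FreeMagma D) :
    graftTree a (FreeMagma.map φ.symm s) (FreeMagma.map ψ.symm t) =
      FreeMagma.map (Graft.congr φ ψ a).symm (graftTree (φ a) s t) := by
  induction s using FreeMagma.recOnMul with
  | ih1 x =>
    by_cases h : x = φ a
    · subst h
      simp [map_map_tree, Graft.congr]
    · have h' : φ.symm x ≠ a := fun e => h (by simp [← e])
      simp [graftTree_of_ne h, graftTree_of_ne h', Graft.congr, Equiv.subtypeEquiv]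
  | ih2 s s' hs hs' => simp [hs, hs']

theorem graftTree_map_inr (b : B) (c : C) (t : FreeMagma C) (u : FreeMagma D) :
    FreeMagma.map (Graft.assoc b c D).symm
        (graftTree (Sum.inr c : Graft b C) (FreeMagma.map Sum.inr t) u) =
      FreeMagma.map Sum.inr (graftTree c t u) := by
  induction t using FreeMagma.recOnMul with
  | ih1 x =>
    by_cases h : x = c
    · subst h; simp [map_map_tree, Graft.assoc]
    · have h' : (Sum.inr x : Graft b C) ≠ Sum.inr c := by simpa using h
      simp [graftTree_of_ne h, graftTree_of_ne h', Graft.assoc]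
  | ih2 s s' hs hs' => simp [hs, hs']

theorem graftTree_assoc (b : B) (c : C) (s : FreeMagma B) (t : FreeMagma C) (u : FreeMagma D) :
    graftTree b s (graftTree c t u) = FreeMagma.map (Graft.assoc b c D).symm
      (graftTree (Sum.inr c : Graft b C) (graftTree b s t) u) := by
  induction s using FreeMagma.recOnMul with
  | ih1 x =>
    by_cases h : x = b
    · subst h; simp [graftTree_map_inr]
    · have h' : (Sum.inl ⟨x, h⟩ : Graft b C) ≠ Sum.inr c := by simp
      simp [graftTree_of_ne h, graftTree_of_ne h', Graft.assoc]
  | ih2 s s' hs hs' => simp [hs, hs']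

theorem graftTree_map_of_ne {b : B} {f : A → B} (hf : ∀ a, f a ≠ b) (t : FreeMagma A)
    (u : FreeMagma C) :
    graftTree b (FreeMagma.map f t) u = FreeMagma.map (fun a => Sum.inl ⟨f a, hf a⟩) t := by
  induction t using FreeMagma.recOnMul with
  | ih1 a => simp [graftTree_of_ne (hf a)]
  | ih2 s s' hs hs' => simp [hs, hs']

theorem graftTree_exchange (b b' : B) (h : b ≠ b') (s : FreeMagma B) (t : FreeMagma C)
    (u : FreeMagma D) :
    graftTree (Sum.inl ⟨b', h.symm⟩ : Graft b C) (graftTree b s t) u =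
      FreeMagma.map (Graft.exchange b b' h C D).symm
        (graftTree (Sum.inl ⟨b, h⟩ : Graft b' D) (graftTree b' s u) t) := by
  induction s using FreeMagma.recOnMul with
  | ih1 x =>
    by_cases h₁ : x = b
    · subst h₁
      simp [graftTree_map_of_ne, graftTree_of_ne h, map_map_tree, Graft.exchange]
    · by_cases h₂ : x = b'
      · subst h₂
        simp [graftTree_map_of_ne, graftTree_of_ne h₁, map_map_tree, Graft.exchange]
      · have h₃ : (Sum.inl ⟨x, h₁⟩ : Graft b C) ≠ Sum.inl ⟨b', h.symm⟩ := by simpa using h₂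
        have h₄ : (Sum.inl ⟨x, h₂⟩ : Graft b' D) ≠ Sum.inl ⟨b, h⟩ := by simpa using h₁
        simp [graftTree_of_ne h₁, graftTree_of_ne h₂, graftTree_of_ne h₃, graftTree_of_ne h₄,
          Graft.exchange]
  | ih2 s s' hs hs' => simp [hs, hs']

theorem map_unitRight_graftTree (b : B) (s : FreeMagma B) :
    FreeMagma.map (Graft.unitRight b).symm (graftTree b s (FreeMagma.of ())) = s := by
  induction s using FreeMagma.recOnMul with
  | ih1 x =>
    by_cases h : x = b
    · subst h; simp [Graft.unitRight]
    · simp [graftTree_of_ne h, Graft.unitRight]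
  | ih2 s s' hs hs' => simp [hs, hs']

theorem magmatic_isOperad : magmatic.IsOperad where
  relabel_refl p := Subtype.ext (map_id_tree p.1)
  relabel_trans φ ψ p := Subtype.ext (map_map_tree φ.symm ψ.symm p.1).symm
  positive h := ⟨fun p => h.elim (rightmost p.1)⟩
  comp_natural φ ψ a p q := Subtype.ext (graftTree_map φ ψ a p.1 q.1)
  comp_assoc b c p q r := Subtype.ext (graftTree_assoc b c p.1 q.1 r.1)
  comp_exchange b b' h p q r := Subtype.ext (graftTree_exchange b b' h p.1 q.1 r.1)
  unit_comp q := Subtype.ext <| by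
    simpa [magmatic, map_map_tree, Graft.unitLeft] using map_id_tree q.1
  comp_unit b p := Subtype.ext (map_unitRight_graftTree b p.1)

/-! ### The ordered pair of a tree -/

/-- The ordered pair of a multilinear tree: `unit` for a single leaf, and for a product `s * t` the
pair formed by the rightmost leaves of `s` and of `t`. -/
def toPair : (t : FreeMagma A) → IsMultilinear t → OrderedPair A
  | .of a, h => .unit a fun x => by simpa [leaves] using h.2 x
  | .mul s t, h => .pair (rightmost s) (rightmost t) fun e =>
      List.disjoint_of_nodup_append h.1 (rightmost_mem_leaves s)
        (e ▸ rightmost_mem_leaves t)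

theorem toPair_of (a : A) (h : IsMultilinear (FreeMagma.of a)) :
    toPair (FreeMagma.of a) h = .unit a fun x => by simpa using h.2 x := rfl

theorem rightmost_ne_of_isMultilinear_mul {s t : FreeMagma A} (h : IsMultilinear (s * t)) :
    rightmost s ≠ rightmost t := fun e =>
  List.disjoint_of_nodup_append (leaves_mul s t ▸ h.1) (rightmost_mem_leaves s)
    (e ▸ rightmost_mem_leaves t)

theorem toPair_mul (s t : FreeMagma A) (h : IsMultilinear (s * t)) :
    toPair (s * t) h =
      .pair (rightmost s) (rightmost t) (rightmost_ne_of_isMultilinear_mul h) := rfl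

theorem toPair_relabel (φ : A ≃ B) (t : FreeMagma B) (h : IsMultilinear t) :
    toPair (FreeMagma.map φ.symm t) (h.map φ) = OrderedPair.relabel φ (toPair t h) := by
  cases t using FreeMagma.recOnMul with
  | ih1 b => rfl
  | ih2 s t =>
    simp only [map_mul, toPair_mul, OrderedPair.relabel, rightmost_map]

theorem toPair_graftTree (b : B) (s : FreeMagma B) (t : FreeMagma C) (hs : IsMultilinear s)
    (ht : IsMultilinear t) :
    toPair (graftTree b s t) (hs.graftTree b ht) =
      OrderedPair.comp b (toPair s hs) (toPair t ht) := by
  cases s using FreeMagma.recOnMul with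
  | ih1 x =>
    have hx : x = b := by simpa [eq_comm] using hs.2 b
    subst hx
    cases t using FreeMagma.recOnMul with
    | ih1 c => simp [toPair_of, OrderedPair.comp]
    | ih2 t t' => simp [toPair_of, toPair_mul, OrderedPair.comp, rightmost_map]
  | ih2 s s' =>
    have hne := rightmost_ne_of_isMultilinear_mul hs
    cases t using FreeMagma.recOnMul with
    | ih1 c => simp [toPair_of, toPair_mul, OrderedPair.comp, rightmost_graftTree]
    | ih2 t t' =>
      simp only [graftTree_mul, toPair_mul, OrderedPair.comp, rightmost_graftTree, rightmost_mul]
      by_cases h₁ : b = rightmost s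
      · subst h₁
        simp [OrderedPair.subst, hne.symm]
      · by_cases h₂ : b = rightmost s'
        · subst h₂
          simp [OrderedPair.subst, hne, hne.symm]
        · simp [OrderedPair.subst, h₁, h₂, Ne.symm h₁, Ne.symm h₂]

/-- Every ordered pair is the pair of a multilinear tree. -/
theorem exists_toPair_eq [Finite A] (p : OrderedPair A) : ∃ t h, toPair t h = p := by
  classical
  cases p with
  | unit a h =>
    exact ⟨.of a, ⟨by simp, fun x => by simp [h x]⟩, rfl⟩
  | pair a' a'' hne =>
    have := Fintype.ofFinite A
    -- the right comb with last leaf `a'` and the letters of `l` as its other leaves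
    have comb : ∀ l : List A, ∃ t : FreeMagma A, leaves t = l ++ [a'] := by
      intro l
      induction l with
      | nil => exact ⟨.of a', rfl⟩
      | cons x l ih =>
        obtain ⟨t, ht⟩ := ih
        exact ⟨.of x * t, by simp [ht]⟩
    obtain ⟨s, hs⟩ := comb ((Finset.univ \ {a', a''} : Finset A).toList)
    have hr : rightmost s = a' := by
      obtain ⟨l, hl⟩ := exists_leaves_eq_append_rightmost s
      rw [hl] at hs
      simpa using (List.append_inj' hs rfl).2
    have hm : IsMultilinear (s * FreeMagma.of a'') := by
      refine ⟨?_, fun x => ?_⟩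
      · simp [hs, List.nodup_append, Finset.nodup_toList, hne]
      · simp [hs]; tauto
    exact ⟨_, hm, by simp [toPair_mul, hr]⟩

/-- The operad morphism from the magmatic operad to the operad of ordered pairs. -/
noncomputable def pairHom : OperadData.Hom magmatic orderedPairs where
  toFun _ _ t := toPair t.1 t.2
  map_relabel φ t := toPair_relabel φ t.1 t.2
  map_unit := rfl
  map_comp b s t := toPair_graftTree b s.1 t.1 s.2 t.2

theorem pairHom_surjective (A : Type) [Finite A] : Function.Surjective (pairHom.toFun A) :=
  fun p => let ⟨t, h, e⟩ := exists_toPair_eq p; ⟨⟨t, h⟩, e⟩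

theorem orderedPairs_isOperad : orderedPairs.IsOperad :=
  magmatic_isOperad.of_surjective pairHom pairHom_surjective

/-! ### Evaluation of trees and the twist identity -/

/-- The value of a tree in a magma with product `m`, the leaf `a` having the value `v a`. -/
def eval {X : Type*} (m : X → X → X) (v : A → X) : FreeMagma A → X
  | .of a => v a
  | .mul s t => m (eval m v s) (eval m v t)

section eval

variable {X : Type*} (m : X → X → X)

@[simp] theorem eval_of (v : A → X) (a : A) : eval m v (FreeMagma.of a) = v a := rfl

@[simp] theorem eval_mul (v : A → X) (s t : FreeMagma A) :
    eval m v (s * t) = m (eval m v s) (eval m v t) := rfl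

theorem eval_map (v : B → X) (f : A → B) (t : FreeMagma A) :
    eval m v (FreeMagma.map f t) = eval m (fun a => v (f a)) t := by
  induction t using FreeMagma.recOnMul with
  | ih1 a => simp
  | ih2 s t hs ht => simp [hs, ht]

theorem eval_congr {v w : A → X} {t : FreeMagma A} (h : ∀ a ∈ leaves t, v a = w a) :
    eval m v t = eval m w t := by
  induction t using FreeMagma.recOnMul with
  | ih1 a => simp [h a (by simp)]
  | ih2 s t hs ht =>
    simp [hs fun a ha => h a (by simp [ha]), ht fun a ha => h a (by simp [ha])]

open Classical in
theorem eval_graftTree (b : B) (s : FreeMagma B) (t : FreeMagma C) (v : Graft b C → X) :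
    eval m v (graftTree b s t) =
      eval m (fun x => if h : x = b then eval m (fun c => v (.inr c)) t else v (.inl ⟨x, h⟩)) s := by
  induction s using FreeMagma.recOnMul with
  | ih1 x =>
    by_cases h : x = b
    · subst h; simp [eval_map]
    · simp [graftTree_of_ne h, h]
  | ih2 s s' hs hs' => simp [hs, hs']

variable {m}

/-- Under the twist identity, left multiplication by a product of letters is the composite of the
left multiplications by these letters. -/
theorem mul_eval_eq_foldl (hm : ∀ x y z, m x (m y z) = m (m y x) z) (v : A → X)
    (t : FreeMagma A) (z : X) :
    m (eval m v t) z = (leaves t).foldl (fun z a => m (v a) z) z := by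
  induction t using FreeMagma.recOnMul generalizing z with
  | ih1 a => simp
  | ih2 s t hs ht => rw [eval_mul, ← hm, ht, hs, leaves_mul, List.foldl_append]

/-- In `x (y z)` the operators of left multiplication by `x` and `y` commute once the whole is
multiplied on the left. -/
theorem mul_left_comm_of_twist (hm : ∀ x y z, m x (m y z) = m (m y x) z) (a x y z : X) :
    m a (m x (m y z)) = m a (m y (m x z)) := by
  calc
    m a (m x (m y z)) = m (m x a) (m y z) := hm _ _ _
    _ = m (m y (m x a)) z := hm _ _ _
    _ = m (m (m x y) a) z := by rw [hm y x a]
    _ = m a (m (m x y) z) := (hm _ _ _).symm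
    _ = m a (m y (m x z)) := by rw [hm y x z]

/-- A nested product of letters around `z`, once multiplied on the left by `a`, does not depend on
the order of the letters. -/
theorem mul_foldl_eq_of_perm (hm : ∀ x y z, m x (m y z) = m (m y x) z) (v : A → X)
    {l l' : List A} (h : l.Perm l') (a z : X) :
    m a (l.foldl (fun z a => m (v a) z) z) = m a (l'.foldl (fun z a => m (v a) z) z) := by
  induction h generalizing a z with
  | nil => rfl
  | cons x _ ih => exact ih a _
  | swap x y l =>
    cases l with
    | nil => exact mul_left_comm_of_twist hm _ _ _ _
    | cons c l =>
      simp only [List.foldl_cons]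
      rw [mul_left_comm_of_twist hm]
  | trans _ _ ih₁ ih₂ => exact (ih₁ a z).trans (ih₂ a z)

/-- Under the twist identity, every tree has the value of a right comb with the same rightmost
leaf. -/
theorem exists_eval_eq_foldl (hm : ∀ x y z, m x (m y z) = m (m y x) z) (v : A → X)
    (t : FreeMagma A) :
    ∃ l, (rightmost t :: l).Perm (leaves t) ∧
      eval m v t = l.foldl (fun z a => m (v a) z) (v (rightmost t)) := by
  induction t using FreeMagma.recOnMul with
  | ih1 a => exact ⟨[], by simp, rfl⟩
  | ih2 s t _ ht =>
    obtain ⟨l, hl, e⟩ := ht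
    refine ⟨l ++ leaves s, ?_, ?_⟩
    · rw [leaves_mul, rightmost_mul, ← List.cons_append]
      exact (hl.append_right _).trans List.perm_append_comm
    · simp [mul_eval_eq_foldl hm, e]

/-- Under the twist identity, the value of a product of two trees depends only on its leaves and
on the rightmost leaves of the two factors. -/
theorem eval_mul_eq_of_rightmost (hm : ∀ x y z, m x (m y z) = m (m y x) z) (v : A → X)
    {s t s' t' : FreeMagma A} (hp : (leaves (s * t)).Perm (leaves (s' * t')))
    (hs : rightmost s = rightmost s') (ht : rightmost t = rightmost t') :
    eval m v (s * t) = eval m v (s' * t') := by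
  obtain ⟨l, hl, e⟩ := exists_eval_eq_foldl hm v t
  obtain ⟨l', hl', e'⟩ := exists_eval_eq_foldl hm v t'
  obtain ⟨k, hk⟩ := exists_leaves_eq_append_rightmost s
  obtain ⟨k', hk'⟩ := exists_leaves_eq_append_rightmost s'
  have key : (l ++ k).Perm (l' ++ k') := by
    classical
    rw [List.perm_iff_count] at hp hl hl' ⊢
    intro c
    have h := hp c
    simp only [leaves_mul, List.count_append, ← hl, ← hl', hk, hk', hs, ht, List.count_cons]
      at h ⊢
    omega
  simp only [eval_mul, mul_eval_eq_foldl hm, hk, hk', e, e', List.foldl_append, List.foldl_cons,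
    List.foldl_nil, hs, ht]
  simpa only [List.foldl_append] using mul_foldl_eq_of_perm hm v key _ _

end eval

/-! ### Generation of the magmatic operad -/

theorem leaves_perm_of_isMultilinear {s t : FreeMagma A} (hs : IsMultilinear s)
    (ht : IsMultilinear t) : (leaves s).Perm (leaves t) :=
  (List.perm_ext_iff_of_nodup hs.1 ht.1).2 fun a => iff_of_true (hs.2 a) (ht.2 a)

theorem IsMultilinear.of_perm {s t : FreeMagma A} (hs : IsMultilinear s)
    (h : (leaves s).Perm (leaves t)) : IsMultilinear t :=
  ⟨h.nodup_iff.1 hs.1, fun a => h.mem_iff.1 (hs.2 a)⟩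

theorem IsMultilinear.injective_of_nodup {q : FreeMagma B} (hq : IsMultilinear q) {f : B → A}
    (h : (leaves (FreeMagma.map f q)).Nodup) : Function.Injective f := by
  rw [leaves_map] at h
  exact fun x y e => List.inj_on_of_nodup_map h (hq.2 x) (hq.2 y) e

/-- A renaming of letters between multilinear trees is a relabelling. -/
theorem exists_equiv_of_map_eq {p : FreeMagma A} {q : FreeMagma B} (hp : IsMultilinear p)
    (hq : IsMultilinear q) {f : B → A} (h : FreeMagma.map f q = p) :
    ∃ φ : A ≃ B, ⇑φ.symm = f := by
  subst h
  refine ⟨(Equiv.ofBijective f ⟨hq.injective_of_nodup hp.1, fun a => ?_⟩).symm, rfl⟩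
  have := hp.2 a
  rw [leaves_map, List.mem_map] at this
  exact this.imp fun _ => And.right

/-- The map out of `B ⊔_b C` given by maps out of `B` and `C`. -/
def Graft.elim {b : B} (f : B → A) (g : C → A) : Graft b C → A :=
  Sum.elim (fun x => f x) g

/-- The product `s * t` of multilinear trees on disjoint sets of leaves, as a partial composite
`(ν ∘₁ s) ∘₂ t`. -/
noncomputable def magmaticMul [Finite B] [Finite C] (s : magmatic.obj B) (t : magmatic.obj C) :
    magmatic.obj (Graft (Sum.inl ⟨1, by decide⟩ : Graft (0 : Fin 2) B) C) :=
  magmatic.comp (Sum.inl ⟨1, by decide⟩ : Graft (0 : Fin 2) B) (magmatic.comp 0 generator s) t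

/-- The value `a` is arbitrary, since no leaf of the generator is left in `(ν ∘₁ s) ∘₂ t`. -/
theorem map_elim_magmaticMul [Finite B] [Finite C] (s : magmatic.obj B) (t : magmatic.obj C)
    (a : A) (f : B → A) (g : C → A) :
    FreeMagma.map (Graft.elim (Graft.elim (fun _ => a) f) g) (magmaticMul s t).1 =
      FreeMagma.map f s.1 * FreeMagma.map g t.1 := by
  simp [magmaticMul, magmatic, generator, graftTree_of_ne, graftTree_map_of_ne, map_map_tree,
    Graft.elim]

/-- Every tree arises by renaming letters from a tree in any class of multilinear trees that
contains the unit and the generator and is closed under partial composition. -/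
theorem exists_map_eq_of_closed {Q : (A : Type) → [Finite A] → magmatic.obj A → Prop}
    (unit : Q Unit magmatic.unit) (gen : Q (Fin 2) generator)
    (comp : ∀ {B C : Type} [Finite B] [Finite C] (b : B) {p : magmatic.obj B}
      {q : magmatic.obj C}, Q B p → Q C q → Q (Graft b C) (magmatic.comp b p q))
    (t : FreeMagma A) :
    ∃ (B : Type) (_ : Finite B) (f : B → A) (p : magmatic.obj B),
      Q B p ∧ FreeMagma.map f p.1 = t := by
  induction t using FreeMagma.recOnMul with
  | ih1 a => exact ⟨Unit, inferInstance, fun _ => a, magmatic.unit, unit, rfl⟩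
  | ih2 s t hs ht =>
    obtain ⟨B, _, f, p, hp, rfl⟩ := hs
    obtain ⟨C, _, g, q, hq, rfl⟩ := ht
    exact ⟨_, inferInstance, _, magmaticMul p q, comp _ (comp _ gen hp) hq,
      map_elim_magmaticMul p q (f (rightmost p.1)) f g⟩

/-- The magmatic operad is generated by `ν`. -/
theorem magmatic_induction {Q : (A : Type) → [Finite A] → magmatic.obj A → Prop}
    (unit : Q Unit magmatic.unit) (gen : Q (Fin 2) generator)
    (relabel : ∀ {A B : Type} [Finite A] [Finite B] (φ : A ≃ B) {p : magmatic.obj B},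
      Q B p → Q A (magmatic.relabel φ p))
    (comp : ∀ {B C : Type} [Finite B] [Finite C] (b : B) {p : magmatic.obj B}
      {q : magmatic.obj C}, Q B p → Q C q → Q (Graft b C) (magmatic.comp b p q))
    [Finite A] (p : magmatic.obj A) : Q A p := by
  obtain ⟨B, _, f, q, hq, e⟩ := exists_map_eq_of_closed (@unit) gen @comp p.1
  obtain ⟨φ, rfl⟩ := exists_equiv_of_map_eq p.2 q.2 e
  have : p = magmatic.relabel φ q := Subtype.ext e.symm
  exact this ▸ relabel φ hq

theorem exists_map_eq (t : FreeMagma A) :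
    ∃ (B : Type) (_ : Finite B) (f : B → A) (p : magmatic.obj B), FreeMagma.map f p.1 = t := by
  obtain ⟨B, _, f, p, -, e⟩ :=
    exists_map_eq_of_closed (Q := fun _ _ _ => True) trivial trivial (fun _ _ _ _ _ => trivial) t
  exact ⟨B, _, f, p, e⟩

/-! ### The operadic congruence on all trees -/

/-- The operadic congruence generated by twist-associativity, on multilinear trees. -/
abbrev TwistCongruence (A : Type) [Finite A] : magmatic.obj A → magmatic.obj A → Prop :=
  OperadData.Congruence magmatic TwistRelation A

/-- The congruence is preserved by a renaming of letters between multilinear trees; such a renaming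
need not be given as a bijection. -/
theorem TwistCongruence.of_map [Finite A] [Finite B] {f : B → A} {q q' : magmatic.obj B}
    {p p' : magmatic.obj A} (h : TwistCongruence B q q') (hp : FreeMagma.map f q.1 = p.1)
    (hp' : FreeMagma.map f q'.1 = p'.1) : TwistCongruence A p p' := by
  obtain ⟨φ, rfl⟩ := exists_equiv_of_map_eq p.2 q.2 hp
  have e : p = magmatic.relabel φ q := Subtype.ext hp.symm
  have e' : p' = magmatic.relabel φ q' := Subtype.ext hp'.symm
  rw [e, e']
  exact .relabel φ h

/-- A tree with the same leaves as the renaming of a multilinear tree along an injection is itself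
such a renaming. -/
theorem exists_map_eq_of_perm [Finite B] {f : B → A} {p : magmatic.obj B} {t : FreeMagma A}
    (hf : Function.Injective f) (h : (leaves (FreeMagma.map f p.1)).Perm (leaves t)) :
    ∃ q : magmatic.obj B, FreeMagma.map f q.1 = t := by
  have : Nonempty B := ⟨rightmost p.1⟩
  have hi := Function.leftInverse_invFun hf
  refine ⟨⟨FreeMagma.map (Function.invFun f) t, p.2.of_perm ?_⟩, ?_⟩
  · have := h.map (Function.invFun f)
    rw [← leaves_map, ← leaves_map, map_map_tree] at this
    simpa [hi _, map_id_tree] using this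
  · rw [map_map_tree]
    refine (map_congr_tree fun a ha => ?_).trans (map_id_tree t)
    rw [← h.mem_iff, leaves_map, List.mem_map] at ha
    obtain ⟨b, -, rfl⟩ := ha
    rw [hi b]

/-- The multiplicative congruence on all trees with leaves in `A` that is induced by the operadic
congruence on multilinear trees: congruent trees have the same leaves, and are operadically
congruent whenever they are multilinear over some set of letters embedded into `A`. -/
def twistCon (A : Type) : Con (FreeMagma A) where
  r s t := (leaves s).Perm (leaves t) ∧ ∀ (B : Type) [Finite B] (f : B → A) (p q : magmatic.obj B),
    Function.Injective f → FreeMagma.map f p.1 = s → FreeMagma.map f q.1 = t →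
      TwistCongruence B p q
  iseqv :=
    { refl := fun s => ⟨.refl _, fun B _ f p q hf hp hq => by
        rw [Subtype.ext (map_injective_tree hf (hp.trans hq.symm))]
        exact .refl _⟩
      symm := fun h => ⟨h.1.symm, fun B _ f p q hf hp hq => (h.2 B f q p hf hq hp).symm⟩
      trans := fun {s t u} h h' => ⟨h.1.trans h'.1, fun B _ f p q hf hp hq => by
        obtain ⟨r, hr⟩ := exists_map_eq_of_perm (p := p) (t := t) hf (hp ▸ h.1)
        exact (h.2 B f p r hf hp hr).trans (h'.2 B f r q hf hr hq)⟩ }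
  mul' := by
    rintro s t s' t' ⟨hl, h⟩ ⟨hl', h'⟩
    refine ⟨by simpa using hl.append hl', fun B _ f p q hf hp hq => ?_⟩
    obtain ⟨p₁, p₂, ep, rfl, rfl⟩ := eq_mul_of_map_eq_mul hp
    obtain ⟨q₁, q₂, eq, rfl, rfl⟩ := eq_mul_of_map_eq_mul hq
    obtain ⟨B₁, _, g₁, r₁, rfl⟩ := exists_map_eq p₁
    obtain ⟨B₂, _, g₂, r₂, rfl⟩ := exists_map_eq p₂
    have hn := p.2.1
    rw [ep, leaves_mul] at hn
    have hg₁ := r₁.2.injective_of_nodup hn.of_append_left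
    have hg₂ := r₂.2.injective_of_nodup hn.of_append_right
    rw [leaves_map f, leaves_map f, List.map_perm_map_iff hf] at hl hl'
    obtain ⟨u₁, rfl⟩ := exists_map_eq_of_perm hg₁ hl
    obtain ⟨u₂, rfl⟩ := exists_map_eq_of_perm hg₂ hl'
    have c₁ := h B₁ _ r₁ u₁ (hf.comp hg₁) (map_map_tree f g₁ _).symm (map_map_tree f g₁ _).symm
    have c₂ := h' B₂ _ r₂ u₂ (hf.comp hg₂) (map_map_tree f g₂ _).symm (map_map_tree f g₂ _).symm
    refine TwistCongruence.of_map (q := magmaticMul r₁ r₂) (q' := magmaticMul u₁ u₂)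
      (.comp _ (.comp _ (.refl _) c₁) c₂)
      ((map_elim_magmaticMul r₁ r₂ (rightmost p.1) g₁ g₂).trans ep.symm)
      ((map_elim_magmaticMul u₁ u₂ (rightmost p.1) g₁ g₂).trans eq.symm)

/-- The induced congruence satisfies the twist identity for arbitrary trees, by substitution of
multilinear trees for the three letters of the defining relation. -/
theorem twistCon_twist (s t u : FreeMagma A) : twistCon A (s * (t * u)) (t * s * u) := by
  refine ⟨?_, fun B _ f p q hf hp hq => ?_⟩
  · simp only [leaves_mul, ← List.append_assoc]
    exact List.perm_append_comm.append_right _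
  obtain ⟨p₁, p', ep, rfl, hp'⟩ := eq_mul_of_map_eq_mul hp
  obtain ⟨p₂, p₃, rfl, rfl, rfl⟩ := eq_mul_of_map_eq_mul hp'
  have eq : q.1 = p₂ * p₁ * p₃ := map_injective_tree hf (by simpa using hq)
  obtain ⟨B₁, _, g₁, r₁, rfl⟩ := exists_map_eq p₁
  obtain ⟨B₂, _, g₂, r₂, rfl⟩ := exists_map_eq p₂
  obtain ⟨B₃, _, g₃, r₃, rfl⟩ := exists_map_eq p₃
  -- `r₁`, `r₂`, `r₃` are grafted onto the leaves `x`, `y`, `z` of `x (y z)` and of `(y x) z`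
  let x : Graft (1 : Fin 2) (Fin 2) := .inl ⟨0, by decide⟩
  let y : Graft x B₁ := .inl ⟨.inr 0, by simp [x]⟩
  let z : Graft y B₂ := .inl ⟨.inl ⟨.inr 1, by simp [x]⟩, by simp [y]⟩
  -- no leaf outside `r₁`, `r₂`, `r₃` is left, so the value `b` of the renaming is never used
  let b := rightmost p.1
  refine TwistCongruence.of_map
    (f := (Graft.elim (Graft.elim (Graft.elim (fun _ => b) g₁) g₂) g₃ : Graft z B₃ → B))
    (.comp z (.comp y (.comp x (.of .twist) (.refl r₁)) (.refl r₂)) (.refl r₃)) ?_ ?_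
  · simp [ep, magmatic, generator, graftTree_of_ne, graftTree_map_of_ne, map_map_tree,
      Graft.elim, x, y, z]
  · simp [eq, magmatic, generator, generatorSwap, twistEquiv, graftTree_of_ne,
      graftTree_map_of_ne, map_map_tree, Graft.elim, x, y, z]

/-- In the quotient magma, the value of a tree at the classes of its letters is its own class. -/
theorem eval_mk (t : FreeMagma A) :
    eval (· * ·) (fun a => (FreeMagma.of a : (twistCon A).Quotient)) t = t := by
  induction t using FreeMagma.recOnMul with
  | ih1 a => rfl
  | ih2 s t hs ht => rw [eval_mul, hs, ht, Con.coe_mul]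

/-- Multilinear trees with the same ordered pair are congruent. -/
theorem twistCongruence_of_toPair_eq [Finite A] {p q : magmatic.obj A}
    (h : toPair p.1 p.2 = toPair q.1 q.2) : TwistCongruence A p q := by
  have key : twistCon A p.1 q.1 := by
    have hl := leaves_perm_of_isMultilinear p.2 q.2
    obtain ⟨p, hp⟩ := p
    obtain ⟨q, hq⟩ := q
    cases p using FreeMagma.recOnMul with
    | ih1 a =>
      cases q using FreeMagma.recOnMul with
      | ih1 b =>
        cases h
        exact (twistCon A).refl _
      | ih2 _ _ => cases h
    | ih2 s t =>
      cases q using FreeMagma.recOnMul with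
      | ih1 b => cases h
      | ih2 s' t' =>
        rw [toPair_mul, toPair_mul] at h
        injection h with h₁ h₂
        rw [← (twistCon A).eq, ← eval_mk, ← eval_mk (s' * t')]
        refine eval_mul_eq_of_rightmost (fun x y z => ?_) _ hl h₁ h₂
        induction x, y using Con.induction_on₂ with | _ x y
        induction z using Con.induction_on with | _ z
        exact ((twistCon A).eq).2 (twistCon_twist x y z)
  exact key.2 A id p q Function.injective_id (map_id_tree _) (map_id_tree _)

theorem toPair_eq_of_twistCongruence [Finite A] {p q : magmatic.obj A}
    (h : TwistCongruence A p q) : toPair p.1 p.2 = toPair q.1 q.2 := by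
  change pairHom.toFun A p = pairHom.toFun A q
  induction h with
  | of h =>
    obtain ⟨⟩ := h
    simp only [pairHom]
    simp [magmatic, generator, generatorSwap, graftTree_of_ne, toPair_mul, twistEquiv]
    rfl
  | refl => rfl
  | symm _ ih => exact ih.symm
  | trans _ _ ih₁ ih₂ => exact ih₁.trans ih₂
  | relabel φ _ ih => rw [pairHom.map_relabel, ih, pairHom.map_relabel]
  | comp b _ _ ih₁ ih₂ => rw [pairHom.map_comp, ih₁, ih₂, pairHom.map_comp]

/-- The bijection that sends the class of a tree to the ordered pair of the tree. -/
noncomputable def twistEquivPair (A : Type) [Finite A] :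
    twistAssociative.obj A ≃ orderedPairs.obj A :=
  Equiv.ofBijective
    (Quotient.lift (pairHom.toFun A) fun _ _ h => toPair_eq_of_twistCongruence h) <| by
    refine ⟨fun x y => ?_, fun p => ?_⟩
    · induction x, y using Quotient.inductionOn₂ with | _ x y
      exact fun h => Quotient.sound (twistCongruence_of_toPair_eq h)
    · obtain ⟨t, rfl⟩ := pairHom_surjective A p
      exact ⟨Quotient.mk _ t, rfl⟩

/-- The isomorphism from the operad of ordered pairs to the twist-associative operad: the pair
`(a', a'')` corresponds to the class of all products `s * t` of trees such that the rightmost leaves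
of `s` and `t` are `a'` and `a''`. -/
noncomputable def orderedPairsIsoTwistAssociative : orderedPairs.Iso twistAssociative where
  equiv A _ := (twistEquivPair A).symm
  map_relabel φ p := by
    obtain ⟨x, rfl⟩ := (twistEquivPair _).surjective p
    rw [Equiv.symm_apply_apply, Equiv.symm_apply_eq]
    induction x using Quotient.inductionOn with | _ t
    exact (pairHom.map_relabel φ t).symm
  map_unit := by
    rw [Equiv.symm_apply_eq]
    exact pairHom.map_unit.symm
  map_comp b p q := by
    obtain ⟨x, rfl⟩ := (twistEquivPair _).surjective p
    obtain ⟨y, rfl⟩ := (twistEquivPair _).surjective q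
    rw [Equiv.symm_apply_apply, Equiv.symm_apply_apply, Equiv.symm_apply_eq]
    induction x, y using Quotient.inductionOn₂ with | _ s t
    exact (pairHom.map_comp b s t).symm

/-! ### Algebras over the twist-associative operad -/

section algebras

variable {k V : Type*} [CommRing k] [AddCommGroup V] [Module k V]

/-- Evaluation in a magma that satisfies the twist identity descends to the twist-associative
operad. -/
theorem eval_eq_of_twistCongruence {X : Type*} {m : X → X → X}
    (hm : ∀ x y z, m x (m y z) = m (m y x) z) [Finite A] {p q : magmatic.obj A}
    (h : TwistCongruence A p q) (v : A → X) : eval m v p.1 = eval m v q.1 := by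
  induction h with
  | of h =>
    obtain ⟨⟩ := h
    simp [magmatic, generator, generatorSwap, graftTree_of_ne, twistEquiv, hm]
  | refl => rfl
  | symm _ ih => exact (ih v).symm
  | trans _ _ ih₁ ih₂ => exact (ih₁ v).trans (ih₂ v)
  | relabel φ _ ih => simpa [magmatic, eval_map] using ih _
  | comp b _ _ ih₁ ih₂ =>
    simp only [magmatic, eval_graftTree, ih₂]
    exact ih₁ _

theorem eval_update_of_notMem [DecidableEq A] {X : Type*} (m : X → X → X) (v : A → X)
    {t : FreeMagma A} {a : A} (ha : a ∉ leaves t) (x : X) :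
    eval m (Function.update v a x) t = eval m v t :=
  eval_congr m fun _ hb => Function.update_of_ne (ne_of_mem_of_not_mem hb ha) _ _

/-- The value of a tree is linear in the value of a leaf that occurs exactly once. -/
theorem exists_linearMap_eval_update [DecidableEq A] (m : V →ₗ[k] V →ₗ[k] V) (v : A → V)
    {t : FreeMagma A} (ht : (leaves t).Nodup) {a : A} (ha : a ∈ leaves t) :
    ∃ l : V →ₗ[k] V, ∀ x, eval (fun x y => m x y) (Function.update v a x) t = l x := by
  induction t using FreeMagma.recOnMul with
  | ih1 b =>
    obtain rfl : a = b := by simpa using ha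
    exact ⟨LinearMap.id, fun x => by simp⟩
  | ih2 s t hs ht' =>
    rw [leaves_mul] at ht ha
    rcases List.mem_append.1 ha with h | h
    · obtain ⟨l, hl⟩ := hs ht.of_append_left h
      have h' : a ∉ leaves t := fun h' => List.disjoint_of_nodup_append ht h h'
      exact ⟨(m.flip (eval (fun x y => m x y) v t)).comp l, fun x => by
        simp [hl, eval_update_of_notMem _ v h']⟩
    · obtain ⟨l, hl⟩ := ht' ht.of_append_right h
      have h' : a ∉ leaves s := fun h' => List.disjoint_of_nodup_append ht h' h
      exact ⟨(m (eval (fun x y => m x y) v s)).comp l, fun x => by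
        simp [hl, eval_update_of_notMem _ v h']⟩

/-- The multilinear operation of a multilinear tree on a module with a bilinear product. -/
noncomputable def evalMultilinear (m : V →ₗ[k] V →ₗ[k] V) [Finite A] (p : magmatic.obj A) :
    MultilinearMap k (fun _ : A => V) V where
  toFun v := eval (fun x y => m x y) v p.1
  map_update_add' v a x y := by
    obtain ⟨l, hl⟩ := exists_linearMap_eval_update m v p.2.1 (p.2.2 a)
    simp only [hl, map_add]
  map_update_smul' v a c x := by
    obtain ⟨l, hl⟩ := exists_linearMap_eval_update m v p.2.1 (p.2.2 a)
    simp only [hl, map_smul]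

/-- The algebra over the twist-associative operad given by a bilinear product that satisfies
`x(yz) = (yx)z`. -/
noncomputable def twistAlgebra (m : V →ₗ[k] V →ₗ[k] V) (hm : ∀ x y z, m x (m y z) = m (m y x) z) :
    twistAssociative.LinearAlgebra k V where
  act A _ := Quotient.lift (evalMultilinear m) fun _ _ h =>
    MultilinearMap.ext fun v => eval_eq_of_twistCongruence (m := fun x y => m x y) hm h v
  act_relabel φ p v := by
    induction p using Quotient.inductionOn with | _ t
    exact eval_map _ _ _ _
  act_unit v := rfl
  act_comp b p q v := by
    induction p, q using Quotient.inductionOn₂ with | _ s t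
    exact eval_graftTree _ b s.1 t.1 v

theorem twistAlgebra_act_generator (m : V →ₗ[k] V →ₗ[k] V)
    (hm : ∀ x y z, m x (m y z) = m (m y x) z) (x y : V) :
    (twistAlgebra m hm).act (Fin 2) twistGenerator ![x, y] = m x y := rfl

/-- An algebra over the twist-associative operad is determined by the action of the generator. -/
theorem linearAlgebra_ext {α β : twistAssociative.LinearAlgebra k V}
    (h : ∀ x y, α.act (Fin 2) twistGenerator ![x, y] = β.act (Fin 2) twistGenerator ![x, y]) :
    α = β := by
  have key : ∀ {A : Type} [Finite A] (p : magmatic.obj A),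
      α.act A (magmatic.toQuotient TwistRelation p) =
        β.act A (magmatic.toQuotient TwistRelation p) := by
    refine magmatic_induction (Q := fun A _ p => α.act A (magmatic.toQuotient TwistRelation p) =
      β.act A (magmatic.toQuotient TwistRelation p)) ?_ ?_ ?_ ?_
    · exact MultilinearMap.ext fun v => (α.act_unit v).trans (β.act_unit v).symm
    · refine MultilinearMap.ext fun v => ?_
      have hv : v = ![v 0, v 1] := by ext i; fin_cases i <;> rfl
      rw [hv]
      exact h _ _
    · intro A B _ _ φ p hp
      refine MultilinearMap.ext fun v => ?_
      refine (α.act_relabel φ (magmatic.toQuotient TwistRelation p) v).trans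
        (Eq.trans ?_ (β.act_relabel φ (magmatic.toQuotient TwistRelation p) v).symm)
      rw [hp]
    · intro B C _ _ b p q hp hq
      refine MultilinearMap.ext fun v => ?_
      refine (α.act_comp b (magmatic.toQuotient TwistRelation p)
        (magmatic.toQuotient TwistRelation q) v).trans (Eq.trans ?_ (β.act_comp b
          (magmatic.toQuotient TwistRelation p) (magmatic.toQuotient TwistRelation q) v).symm)
      rw [hp, hq]
  refine OperadData.LinearAlgebra.ext ?_
  funext A _ p
  induction p using Quotient.inductionOn with | _ t
  exact key t

theorem act_generator_twist (α : twistAssociative.LinearAlgebra k V) (x y z : V) :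
    α.act (Fin 2) twistGenerator ![x, α.act (Fin 2) twistGenerator ![y, z]] =
      α.act (Fin 2) twistGenerator ![α.act (Fin 2) twistGenerator ![y, x], z] := by
  have e : twistAssociative.comp (1 : Fin 2) twistGenerator twistGenerator =
      twistAssociative.relabel twistEquiv (twistAssociative.comp (0 : Fin 2) twistGenerator
        (twistAssociative.relabel (Equiv.swap (0 : Fin 2) 1) twistGenerator)) :=
    Quotient.sound (.of .twist)
  have h := congrArg (fun p => α.act _ p (Sum.elim (fun _ => x) ![y, z])) e
  simp only [α.act_comp, α.act_relabel] at h
  convert h using 2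
  · ext i; fin_cases i
    · simp
    · simp
  · ext i; fin_cases i
    · simp
      congr 1
      ext i; fin_cases i <;> simp [twistEquiv]
    · simp [twistEquiv]

end algebras

end SpeciesOperad

theorem mainTheorem4 :
    SpeciesOperad.orderedPairs.IsOperad ∧
    Nonempty (SpeciesOperad.OperadData.Iso SpeciesOperad.orderedPairs
      SpeciesOperad.twistAssociative) ∧
    ∀ (k V : Type*) [CommRing k] [AddCommGroup V] [Module k V],
      (∀ (α : SpeciesOperad.twistAssociative.LinearAlgebra k V) (x y z : V),
        α.act (Fin 2) SpeciesOperad.twistGenerator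
            ![x, α.act (Fin 2) SpeciesOperad.twistGenerator ![y, z]] =
          α.act (Fin 2) SpeciesOperad.twistGenerator
            ![α.act (Fin 2) SpeciesOperad.twistGenerator ![y, x], z]) ∧
      (∀ m : V →ₗ[k] V →ₗ[k] V, (∀ x y z : V, m x (m y z) = m (m y x) z) →
        ∃! α : SpeciesOperad.twistAssociative.LinearAlgebra k V,
          ∀ x y : V, α.act (Fin 2) SpeciesOperad.twistGenerator ![x, y] = m x y) := by
  refine ⟨SpeciesOperad.orderedPairs_isOperad,
    ⟨SpeciesOperad.orderedPairsIsoTwistAssociative⟩, fun k V _ _ _ =>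
      ⟨SpeciesOperad.act_generator_twist, fun m hm =>
        ⟨SpeciesOperad.twistAlgebra m hm, SpeciesOperad.twistAlgebra_act_generator m hm,
          fun α hα => SpeciesOperad.linearAlgebra_ext fun x y => ?_⟩⟩⟩
  rw [hα, SpeciesOperad.twistAlgebra_act_generator]
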